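/- Fix $\delta\in(-1,1)$, $\beta\in(0,1)$ and $\phi:\{0,1,2,\dots\}\to[0,1]$ with $\phi(n)=n^{-\beta}$ for every $n\ge 1$ (the value $\phi(0)\in[0,1]$ is arbitrary). On a probability space $(\Omega,\mathcal F,\mathbb P)$ let $\chi_0,\chi_1,\dots$ be independent $\{0,1\}$-valued random variables with $\mathbb P[\chi_n=1]=\phi(n)$, and let $\xi_0,\xi_1,\dots$ be i.i.d. $(0,1)$-valued random variables, the sequence $(\xi_n)$ being independent of the sequence $(\chi_n)$. Put $$p_n=\frac{1-\delta}{2}\,\chi_n+\xi_n(1-\chi_n),\qquad \zeta_n=\log\frac{\xi_n}{1-\xi_n}.$$ Given the environment $\omega=(p_0,p_1,\dots)$, let $X=(X_t)_{t\ge 0}$ be the nearest-neighbour Markov chain on $\{0,1,2,\dots\}$ which from $n\ge1$ moves to $n-1$ with probability $p_n$ and to $n+1$ with probability $1-p_n$, and which from $0$ stays at $0$ with probability $p_0$ and moves to $1$ with probability $1-p_0$. The chain $X$ is called recurrent if, for every site $x$, started from $x$ it returns to $x$ with probability one, and transient if, for every site $x$, this probability is less than one. Assume that the law of $\zeta_0$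 is symmetric, that is, $\mathbb P[\zeta_0\le -x]=\mathbb P[\zeta_0\ge x]$ for all $x\ge 0$, and that $0<\mathbb E[\zeta_0^2]<\infty$. (i) Suppose that $\beta<\frac12$. If $\delta<0$, then $X$ is recurrent for $\mathbb P$-almost every $\omega$. If $\delta>0$, then $X$ is transient for $\mathbb P$-almost every $\omega$. (ii) Suppose that $\beta>\frac12$. Then, for every $\delta\in(-1,1)$, $X$ is recurrent for $\mathbb P$-almost every $\omega$. -/

import Mathlib

open MeasureTheory ProbabilityTheory

/-- An environment `(p₀, p₁, …)` on `ℤ₊`: at the site `n` the walk steps to the left with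
probability `p n ∈ (0, 1)` and to the right with probability `q n = 1 - p n`. -/
abbrev RWEnvironment : Type := ℕ → Set.Ioo (0 : ℝ) 1

namespace RWEnvironment

/-- The law of the next position of the walk that is at the site `n`: mass `p n` at `n - 1` and
mass `q n = 1 - p n` at `n + 1`. The subtraction is that of `ℕ`, so that `0 - 1 = 0`: from the
origin the walk stays at `0` with probability `p 0` and moves to `1` with probability `q 0`. -/
noncomputable def stepLaw (p : RWEnvironment) (n : ℕ) : Measure ℕ :=
  ENNReal.ofReal (p n : ℝ) • Measure.dirac (n - 1) +
    ENNReal.ofReal (1 - (p n : ℝ)) • Measure.dirac (n + 1)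

instance isProbabilityMeasure_stepLaw (p : RWEnvironment) (n : ℕ) :
    IsProbabilityMeasure (p.stepLaw n) := by
  constructor
  have h0 : (0 : ℝ) ≤ (p n : ℝ) := (p n).2.1.le
  have h1 : (0 : ℝ) ≤ 1 - (p n : ℝ) := sub_nonneg.2 (p n).2.2.le
  simp only [stepLaw, Measure.add_apply, Measure.smul_apply, measure_univ, smul_eq_mul, mul_one]
  rw [← ENNReal.ofReal_add h0 h1]
  simp

/-- The one-step transition kernel of the walk in the environment `p`, as a function of the whole
history up to time `t`, of which only the current position matters. -/
noncomputable def historyKernel (p : RWEnvironment) (t : ℕ) :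
    Kernel ((i : Finset.Iic t) → (fun _ : ℕ => ℕ) i) ((fun _ : ℕ => ℕ) (t + 1)) :=
  (Kernel.ofFunOfCountable p.stepLaw).comap
    (fun h => h ⟨t, Finset.mem_Iic.2 le_rfl⟩) (measurable_pi_apply _)

instance isMarkovKernel_historyKernel (p : RWEnvironment) (t : ℕ) :
    IsMarkovKernel (p.historyKernel t) :=
  ⟨fun h => isProbabilityMeasure_stepLaw p (h ⟨t, Finset.mem_Iic.2 le_rfl⟩)⟩

/-- The quenched law, on the space of trajectories `(X₀, X₁, …)`, of the walk in the environment
`p` started from `X₀ = x`. -/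
noncomputable def quenchedLaw (p : RWEnvironment) (x : ℕ) : Measure (ℕ → ℕ) :=
  Kernel.trajMeasure (X := fun _ : ℕ => ℕ) (Measure.dirac x) p.historyKernel

/-- The walk in the environment `p` is recurrent: for every site `x`, the walk started from `x`
returns to `x` with probability one. -/
def IsRecurrent (p : RWEnvironment) : Prop :=
  ∀ x : ℕ, p.quenchedLaw x {X | ∃ t : ℕ, 0 < t ∧ X t = x} = 1

/-- The walk in the environment `p` is transient: for every site `x`, the walk started from `x`
returns to `x` with probability less than one. -/
def IsTransient (p : RWEnvironment) : Prop :=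
  ∀ x : ℕ, p.quenchedLaw x {X | ∃ t : ℕ, 0 < t ∧ X t = x} < 1

end RWEnvironment

/-!
The log-odds `log (p j / q j)` are the steps of the potential `V n = ∑_{j < n} log (p j / q j)`, and
the walk is recurrent or transient according as `∑ exp (V n)` diverges or converges
(`RWEnvironment.isRecurrent_of_not_summable`, `RWEnvironment.isTransient_of_summable`). Indeed the
probability `a y` of never visiting `x` at a positive time is the limit of powers of the walk
operator killed at `x`, so, set to zero at `x`, it is harmonic off `x`. To the left of `x` it
vanishes by reflection at the origin; to the right it is a multiple of the increment of the scale
function `∑ exp V`. If that function is unbounded, the multiple is zero because `a ≤ 1`; if it is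
bounded, its normalised increment is a lower bound for `a`.

In the random environment `V n` is a sum of independent variables
`U k = ζ k + χ k * (c - ζ k)` with `c = log ((1 - δ) / (1 + δ))`, of mean `c * φ k`.

* For `β < 1 / 2` the mean of `V n` has the sign of `c` and order `n ^ (1 - β)`, whereas the
  fluctuations are almost surely `O(n ^ γ)` for every `γ > 1 / 2` (`ae_exists_abs_sum_le`, by
  convergence of an `L²`-bounded martingale and Abel summation). So `V n` tends to `+∞` or `-∞`
  like a power of `n`.
* For `β > 1 / 2` the contribution of the sites with `χ k = 1` is `o(√n)` in `L¹`, so `V n / √n` is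
  asymptotically normal by the central limit theorem, and `V n ≥ 0` has probability bounded below
  (`exists_le_measure_sum_add_nonneg`). Hence `V n ≥ 0` infinitely often with positive probability,
  on which event `∑ exp (V n)` diverges. Divergence is a tail event, so it has probability one by
  Kolmogorov's zero-one law (`ae_not_summable_exp_sum`).
-/

/-! ### The quenched walk: avoiding a site -/

namespace RWEnvironment

open Filter Topology Finset in
/-- The Markov property at time `n`: a functional of the trajectory up to time `n`, multiplied by
a function of the next position, may be averaged over the step law at the current position. -/
theorem lintegral_quenchedLaw_mul_succ (p : RWEnvironment) (y n : ℕ)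
    (F : (ℕ → ℕ) → ENNReal) (F' : ((i : Finset.Iic n) → ℕ) → ENNReal) (hF' : Measurable F')
    (hF : ∀ X, F X = F' (fun i => X i)) (G : ℕ → ENNReal) :
    ∫⁻ X, F X * G (X (n + 1)) ∂p.quenchedLaw y =
      ∫⁻ X, F X * ∫⁻ z, G z ∂p.stepLaw (X n) ∂p.quenchedLaw y := by
  have key := Kernel.map_frestrictLe_trajMeasure_compProd_eq_map_trajMeasure
    (X := fun _ : ℕ => ℕ) (μ₀ := Measure.dirac y) (κ := p.historyKernel) (a := n)
  have hG : Measurable G := measurable_of_countable G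
  set H : ((i : Finset.Iic n) → ℕ) × ℕ → ENNReal := fun q => F' q.1 * G q.2 with hH
  have hHm : Measurable H := (hF'.comp measurable_fst).mul (hG.comp measurable_snd)
  have h1 : ∫⁻ X, F X * G (X (n + 1)) ∂p.quenchedLaw y =
      ∫⁻ q, H q ∂(p.quenchedLaw y).map
        (fun x => (Preorder.frestrictLe (π := fun _ : ℕ => ℕ) n x, x (n + 1))) := by
    rw [lintegral_map hHm (by fun_prop)]
    refine lintegral_congr fun X => ?_
    rw [hF]; rfl
  rw [h1]
  unfold quenchedLaw
  rw [← key, Measure.lintegral_compProd hHm, lintegral_map hHm.lintegral_kernel_prod_right'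
    (by fun_prop)]
  refine lintegral_congr fun X => ?_
  simp only [hH]
  rw [lintegral_const_mul _ hG, hF]
  rfl

theorem lintegral_stepLaw (p : RWEnvironment) (n : ℕ) (G : ℕ → ENNReal) :
    ∫⁻ z, G z ∂p.stepLaw n =
      ENNReal.ofReal (p n : ℝ) * G (n - 1) + ENNReal.ofReal (1 - (p n : ℝ)) * G (n + 1) := by
  simp [stepLaw]

theorem map_zero_quenchedLaw (p : RWEnvironment) (y : ℕ) :
    (p.quenchedLaw y).map (fun X => X 0) = Measure.dirac y := by
  have h : (fun X : ℕ → ℕ => X 0) =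
      (fun h : (i : Finset.Iic 0) → ℕ => h ⟨0, Finset.mem_Iic.2 le_rfl⟩) ∘
        (Preorder.frestrictLe (π := fun _ : ℕ => ℕ) 0) := rfl
  rw [h, ← Measure.map_map (by fun_prop) (by fun_prop)]
  unfold quenchedLaw Kernel.trajMeasure
  rw [Measure.map_comp _ _ (by fun_prop), Kernel.traj_map_frestrictLe, Kernel.partialTraj_self,
    Measure.id_comp, Measure.map_map (by fun_prop) (by fun_prop)]
  exact Measure.map_id

instance (p : RWEnvironment) (y : ℕ) : IsProbabilityMeasure (p.quenchedLaw y) := by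
  unfold quenchedLaw; infer_instance

/-- The trajectories that do not visit `x` at any of the times `1, …, n`. -/
def avoid (x n : ℕ) : Set (ℕ → ℕ) := {X | ∀ i, 0 < i → i ≤ n → X i ≠ x}

/-- The one-step operator of the walk killed upon stepping to `x`. -/
noncomputable def killedStep (p : RWEnvironment) (x : ℕ) (G : ℕ → ENNReal) (y : ℕ) : ENNReal :=
  ∫⁻ z, (if z = x then 0 else G z) ∂p.stepLaw y

theorem measurableSet_avoid (x n : ℕ) : MeasurableSet (avoid x n) := by
  have : avoid x n = ⋂ i, ⋂ (_ : 0 < i), ⋂ (_ : i ≤ n), (fun X : ℕ → ℕ => X i) ⁻¹' {x}ᶜ := by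
    ext X; simp [avoid]
  rw [this]
  refine MeasurableSet.iInter fun i => MeasurableSet.iInter fun _ => MeasurableSet.iInter fun _ => ?_
  exact measurable_pi_apply i (MeasurableSet.singleton x).compl

/-- Iterating the Markov property from the last step backwards gives powers of the killed operator,
and so the first-step decomposition without a shift of the trajectory space. -/
theorem lintegral_avoid_mul (p : RWEnvironment) (x y n : ℕ) (G : ℕ → ENNReal) :
    ∫⁻ X, (avoid x n).indicator 1 X * G (X n) ∂p.quenchedLaw y = (p.killedStep x)^[n] G y := by
  classical
  induction n generalizing G with
  | zero =>
    have h : ∀ X : ℕ → ℕ, X ∈ avoid x 0 := fun X i h1 h2 => by omega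
    have hG : Measurable G := measurable_of_countable G
    simp only [Set.indicator_of_mem (h _), Pi.one_apply, one_mul, Function.iterate_zero, id]
    rw [← lintegral_map (μ := p.quenchedLaw y) (g := fun X : ℕ → ℕ => X 0) hG (by fun_prop),
      map_zero_quenchedLaw, lintegral_dirac]
  | succ n ih =>
    have h : ∀ X : ℕ → ℕ, (avoid x (n + 1)).indicator 1 X * G (X (n + 1)) =
        (avoid x n).indicator 1 X * (if X (n + 1) = x then 0 else G (X (n + 1))) := by
      intro X
      have hiff : X ∈ avoid x (n + 1) ↔ X ∈ avoid x n ∧ X (n + 1) ≠ x := by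
        constructor
        · exact fun h => ⟨fun i h1 h2 => h i h1 (by omega), h _ (by omega) le_rfl⟩
        · rintro ⟨h1, h2⟩ i hi hi'
          rcases Nat.lt_or_ge n i with h3 | h3
          · rwa [show i = n + 1 by omega]
          · exact h1 i hi h3
      by_cases h1 : X ∈ avoid x n <;> by_cases h2 : X (n + 1) = x <;>
        simp [hiff, h1, h2]
    simp_rw [h]
    rw [lintegral_quenchedLaw_mul_succ p y n (fun X => (avoid x n).indicator 1 X)
      (({h | ∀ i : Finset.Iic n, 0 < (i : ℕ) → h i ≠ x} : Set ((i : Finset.Iic n) → ℕ)).indicator 1)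
      (measurable_of_countable _) ?_ (fun z => if z = x then 0 else G z)]
    · exact ih (p.killedStep x G)
    · intro X
      simp only [Set.indicator_apply, avoid, Set.mem_ofPred_eq, Subtype.forall, Finset.mem_Iic]
      congr 1
      exact propext ⟨fun h i h1 h2 => h i h2 h1, fun h i h1 h2 => h i h2 h1⟩

/-- The probability that the walk started from `y` avoids `x` at the times `1, …, n`. -/
noncomputable def avoidProb (p : RWEnvironment) (x n y : ℕ) : ℝ := (p.quenchedLaw y).real (avoid x n)

theorem avoidProb_zero (p : RWEnvironment) (x y : ℕ) : p.avoidProb x 0 y = 1 := by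
  have h : avoid x 0 = Set.univ := Set.eq_univ_of_forall fun X i h1 h2 => by omega
  simp [avoidProb, h]

/-- First-step decomposition of the avoidance probabilities. -/
theorem avoidProb_succ (p : RWEnvironment) (x n y : ℕ) :
    p.avoidProb x (n + 1) y =
      p y * (if y - 1 = x then 0 else p.avoidProb x n (y - 1)) +
        (1 - p y) * (if y + 1 = x then 0 else p.avoidProb x n (y + 1)) := by
  have h : ∀ n y, p.quenchedLaw y (avoid x n) = (p.killedStep x)^[n] 1 y := fun n y => by
    rw [← lintegral_avoid_mul]
    simp [lintegral_indicator_one (measurableSet_avoid x n)]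
  have hp0 : (0 : ℝ) ≤ p y := (p y).2.1.le
  have hp1 : (0 : ℝ) ≤ 1 - p y := sub_nonneg.2 (p y).2.2.le
  have h2 : p.quenchedLaw y (avoid x (n + 1)) =
      ENNReal.ofReal (p y) * (if y - 1 = x then 0 else p.quenchedLaw (y - 1) (avoid x n)) +
      ENNReal.ofReal (1 - p y) * (if y + 1 = x then 0 else p.quenchedLaw (y + 1) (avoid x n)) := by
    rw [h, Function.iterate_succ_apply', killedStep, lintegral_stepLaw, h, h]
  have h3 : ∀ z : ℕ, (if z = x then 0 else p.quenchedLaw z (avoid x n)) ≠ ⊤ := fun z => by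
    split_ifs <;> simp
  unfold avoidProb Measure.real
  rw [h2, ENNReal.toReal_add (ENNReal.mul_ne_top (by simp) (h3 _))
    (ENNReal.mul_ne_top (by simp) (h3 _)), ENNReal.toReal_mul, ENNReal.toReal_mul,
    ENNReal.toReal_ofReal hp0, ENNReal.toReal_ofReal hp1]
  simp only [apply_ite ENNReal.toReal, ENNReal.toReal_zero]

/-- The probability that the walk started from `y` never visits `x` at a positive time. -/
noncomputable def escapeProb (p : RWEnvironment) (x y : ℕ) : ℝ :=
  (p.quenchedLaw y).real {X | ∃ t : ℕ, 0 < t ∧ X t = x}ᶜ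

theorem measurableSet_return (x : ℕ) : MeasurableSet {X : ℕ → ℕ | ∃ t : ℕ, 0 < t ∧ X t = x} := by
  have : {X : ℕ → ℕ | ∃ t : ℕ, 0 < t ∧ X t = x} =
      ⋃ t, ⋃ (_ : 0 < t), (fun X : ℕ → ℕ => X t) ⁻¹' {x} := by
    ext X; simp
  rw [this]
  exact MeasurableSet.iUnion fun t => MeasurableSet.iUnion fun _ =>
    measurable_pi_apply t (MeasurableSet.singleton x)

open Filter Topology in
theorem tendsto_avoidProb (p : RWEnvironment) (x y : ℕ) :
    Tendsto (fun n => p.avoidProb x n y) atTop (𝓝 (p.escapeProb x y)) := by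
  have h : {X : ℕ → ℕ | ∃ t : ℕ, 0 < t ∧ X t = x}ᶜ = ⋂ n, avoid x n := by
    ext X
    simp only [Set.mem_compl_iff, Set.mem_ofPred_eq, not_exists, not_and, Set.mem_iInter, avoid]
    exact ⟨fun h n i h1 _ => h i h1, fun h t ht => h t t ht le_rfl⟩
  unfold avoidProb escapeProb Measure.real
  rw [h]
  refine (ENNReal.tendsto_toReal (measure_ne_top _ _)).comp ?_
  refine MeasureTheory.tendsto_measure_iInter_atTop
    (fun n => (measurableSet_avoid x n).nullMeasurableSet) ?_ ⟨0, measure_ne_top _ _⟩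
  exact fun m n hmn X hX i h1 h2 => hX i h1 (h2.trans hmn)

/-- First-step decomposition of the escape probability. Off `x`, it says that the escape
probability, set to `0` at `x`, is harmonic. -/
theorem escapeProb_eq (p : RWEnvironment) (x y : ℕ) :
    p.escapeProb x y =
      p y * (if y - 1 = x then 0 else p.escapeProb x (y - 1)) +
        (1 - p y) * (if y + 1 = x then 0 else p.escapeProb x (y + 1)) := by
  refine tendsto_nhds_unique
    ((Filter.tendsto_add_atTop_iff_nat 1).2 (p.tendsto_avoidProb x y)) ?_
  simp_rw [avoidProb_succ]
  have h : ∀ z : ℕ, Filter.Tendsto (fun n => if z = x then 0 else p.avoidProb x n z) Filter.atTop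
      (nhds (if z = x then 0 else p.escapeProb x z)) := fun z => by
    split_ifs
    · exact tendsto_const_nhds
    · exact p.tendsto_avoidProb x z
  exact ((h _).const_mul _).add ((h _).const_mul _)

theorem escapeProb_mem (p : RWEnvironment) (x y : ℕ) : p.escapeProb x y ∈ Set.Icc (0 : ℝ) 1 :=
  ⟨measureReal_nonneg, measureReal_le_one⟩

theorem isRecurrent_iff_escapeProb (p : RWEnvironment) :
    p.IsRecurrent ↔ ∀ x, p.escapeProb x x = 0 := by
  refine forall_congr' fun x => ?_
  rw [escapeProb, measureReal_eq_zero_iff (measure_ne_top _ _),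
    prob_compl_eq_zero_iff (measurableSet_return x)]

theorem isTransient_iff_escapeProb (p : RWEnvironment) :
    p.IsTransient ↔ ∀ x, 0 < p.escapeProb x x := by
  refine forall_congr' fun x => ?_
  have h := prob_compl_eq_zero_iff (μ := p.quenchedLaw x) (measurableSet_return x)
  rw [escapeProb, measureReal_nonneg.lt_iff_ne, ne_comm, Ne,
    measureReal_eq_zero_iff (measure_ne_top _ _), h, prob_le_one.lt_iff_ne]

/-! ### The potential and the recurrence criterion -/

/-- The potential `V n = ∑_{j < n} log (p j / q j)` of the environment. -/
noncomputable def potential (p : RWEnvironment) (n : ℕ) : ℝ :=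
  ∑ j ∈ Finset.range n, Real.log (p j / (1 - p j))

/-- The scale function of the walk, harmonic at every site other than `0`. The sum over `j ≤ k` in
the exponent includes `log (p 0 / q 0)`, which only multiplies the function by a constant. -/
noncomputable def scale (p : RWEnvironment) (y : ℕ) : ℝ :=
  ∑ k ∈ Finset.range y, Real.exp (p.potential (k + 1))

theorem scale_succ_sub (p : RWEnvironment) (y : ℕ) :
    p.scale (y + 1) - p.scale y = Real.exp (p.potential (y + 1)) := by
  simp [scale, Finset.sum_range_succ]

/-- Detailed balance, which makes the scale function harmonic at every site `y ≥ 1`. -/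
theorem exp_potential_succ (p : RWEnvironment) (y : ℕ) :
    (1 - p y) * Real.exp (p.potential (y + 1)) = p y * Real.exp (p.potential y) := by
  have hp0 : (0 : ℝ) < p y := (p y).2.1
  have hp1 : (0 : ℝ) < 1 - p y := sub_pos.2 (p y).2.2
  rw [potential, Finset.sum_range_succ, Real.exp_add, Real.exp_log (by positivity), potential]
  field_simp

theorem strictMono_scale (p : RWEnvironment) : StrictMono p.scale :=
  strictMono_nat_of_lt_succ fun n => by
    have := p.scale_succ_sub n
    have := Real.exp_pos (p.potential (n + 1))
    linarith

/-- To the right of `x` a function vanishing at `x` and harmonic on `(x, ∞)` is a multiple of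
the increment of the scale function. -/
theorem eq_mul_scale_sub (p : RWEnvironment) (x : ℕ) (u : ℕ → ℝ) (hx : u x = 0)
    (hu : ∀ y, x < y → u y = p y * u (y - 1) + (1 - p y) * u (y + 1)) (k : ℕ) :
    u (x + k) = u (x + 1) / Real.exp (p.potential (x + 1)) * (p.scale (x + k) - p.scale x) := by
  set A := u (x + 1) / Real.exp (p.potential (x + 1)) with hA
  have hinc : ∀ k, u (x + k + 1) - u (x + k) = A * Real.exp (p.potential (x + k + 1)) := by
    intro k
    induction k with
    | zero => simp [hx, hA, (Real.exp_pos _).ne']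
    | succ k ih =>
      have h1 := hu (x + (k + 1)) (by omega)
      have h2 := p.exp_potential_succ (x + (k + 1))
      have hp1 : (0 : ℝ) < 1 - p (x + (k + 1)) := sub_pos.2 (p _).2.2
      have h3 : x + (k + 1) - 1 = x + k := by omega
      rw [h3] at h1
      rw [show x + k + 1 = x + (k + 1) by omega] at ih
      have h4 : (1 - p (x + (k + 1)) : ℝ) * (u (x + (k + 1) + 1) - u (x + (k + 1))) =
          p (x + (k + 1)) * (u (x + (k + 1)) - u (x + k)) := by linarith
      refine mul_left_cancel₀ hp1.ne' ?_
      rw [h4, ih]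
      linear_combination (-A) * h2
  induction k with
  | zero => simp [hx]
  | succ k ih =>
    have h1 := hinc k
    have h2 := p.scale_succ_sub (x + k)
    rw [← add_assoc]
    linear_combination h1 + ih - A * h2

open Filter Topology in
/-- If `∑ exp (V n)` diverges, the walk is recurrent. A bounded multiple of the increments of the
scale function vanishes, so the walk never escapes to the right; on the finitely many sites to
the left of `x` the escape probability is constant by reflection at the origin. -/
theorem isRecurrent_of_not_summable (p : RWEnvironment)
    (h : ¬ Summable fun n => Real.exp (p.potential n)) : p.IsRecurrent := by
  rw [isRecurrent_iff_escapeProb]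
  intro x
  set u : ℕ → ℝ := fun y => if y = x then 0 else p.escapeProb x y with hu
  have hux : u x = 0 := by simp [hu]
  have hharm : ∀ y, p.escapeProb x y = p y * u (y - 1) + (1 - p y) * u (y + 1) :=
    fun y => p.escapeProb_eq x y
  have huy : ∀ y, y ≠ x → u y = p.escapeProb x y := fun y hy => by simp [hu, hy]
  have hright : u (x + 1) = 0 := by
    have hlim : Tendsto p.scale atTop atTop := by
      refine (not_summable_iff_tendsto_nat_atTop_of_nonneg fun n => (Real.exp_pos _).le).1 ?_
      exact fun h' => h ((summable_nat_add_iff 1).1 h')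
    have hlim' : Tendsto (fun k => p.scale (x + k) - p.scale x) atTop atTop :=
      by
      refine tendsto_atTop_add_const_right _ _ ?_
      simpa only [add_comm] using (tendsto_add_atTop_iff_nat x).2 hlim
    have h0 : 0 ≤ u (x + 1) := by rw [huy _ (by omega)]; exact (p.escapeProb_mem _ _).1
    by_contra hne
    have hpos : 0 < u (x + 1) / Real.exp (p.potential (x + 1)) :=
      div_pos (h0.lt_of_ne (Ne.symm hne)) (Real.exp_pos _)
    obtain ⟨k, hk⟩ := ((hlim'.const_mul_atTop hpos).eventually_gt_atTop 1).exists
    rw [← p.eq_mul_scale_sub x u hux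
      (fun y hy => by rw [huy y (by omega)]; exact hharm y)] at hk
    have : u (x + k) ≤ 1 := by
      by_cases hk0 : x + k = x
      · rw [hk0, hux]; norm_num
      · rw [huy _ hk0]; exact (p.escapeProb_mem _ _).2
    linarith
  have hleft : u (x - 1) = 0 := by
    have hconst : ∀ y, y < x → u (y + 1) = u y := by
      intro y
      induction y with
      | zero =>
        intro hy
        have h1 := hharm 0
        have hp1 : (0 : ℝ) < 1 - p 0 := sub_pos.2 (p 0).2.2
        rw [← huy 0 (by omega)] at h1
        refine mul_left_cancel₀ hp1.ne' ?_
        simp only [Nat.zero_sub] at h1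
        linarith
      | succ y ih =>
        intro hy
        have h1 := hharm (y + 1)
        have hp1 : (0 : ℝ) < 1 - p (y + 1) := sub_pos.2 (p _).2.2
        rw [← huy (y + 1) (by omega), Nat.add_sub_cancel, ← ih (by omega)] at h1
        refine mul_left_cancel₀ hp1.ne' ?_
        linarith
    rcases Nat.eq_zero_or_pos x with rfl | hx
    · simpa using hux
    · rw [← hconst (x - 1) (by omega), Nat.sub_add_cancel hx, hux]
  rw [hharm, hleft, hright]
  simp

/-- If `∑ exp (V n)` converges, the walk is transient: the scale function, normalised to take the
values `0` at `x` and `1` at infinity, bounds the escape probability from below. -/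
theorem isTransient_of_summable (p : RWEnvironment)
    (h : Summable fun n => Real.exp (p.potential n)) : p.IsTransient := by
  rw [isTransient_iff_escapeProb]
  intro x
  have hsum : Summable fun n => Real.exp (p.potential (n + 1)) :=
    (summable_nat_add_iff (f := fun n => Real.exp (p.potential n)) 1).2 h
  obtain ⟨S, hS⟩ : ∃ S, S = ∑' n, Real.exp (p.potential (n + 1)) := ⟨_, rfl⟩
  have hle : ∀ y, p.scale y ≤ S := fun y => by
    rw [hS]; exact hsum.sum_le_tsum (Finset.range y) fun n _ => Real.exp_nonneg _
  have hlt : p.scale x < S := (p.strictMono_scale (Nat.lt_succ_self x)).trans_le (hle _)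
  have hd : 0 < S - p.scale x := sub_pos.2 hlt
  set b : ℕ → ℝ := fun y => (p.scale (max x y) - p.scale x) / (S - p.scale x) with hb
  have hb0 : ∀ y, 0 ≤ b y := fun y =>
    div_nonneg (sub_nonneg.2 (p.strictMono_scale.monotone (le_max_left _ _))) hd.le
  have hbx : ∀ y, y ≤ x → b y = 0 := fun y hy => by simp [hb, hy]
  have hbx' : ∀ y, x ≤ y → b y = (p.scale y - p.scale x) / (S - p.scale x) := fun y hy => by
    simp [hb, hy]
  -- `b` vanishes at `x`, so the killing at `x` does not affect it
  have hb_sub : ∀ y, b y ≤ p y * b (y - 1) + (1 - p y) * b (y + 1) := by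
    intro y
    have hp0 : (0 : ℝ) < p y := (p y).2.1
    have hp1 : (0 : ℝ) < 1 - p y := sub_pos.2 (p y).2.2
    rcases Nat.lt_or_ge x y with hy | hy
    · obtain ⟨k, rfl⟩ : ∃ k, y = k + 1 := ⟨y - 1, by omega⟩
      rw [hbx' _ hy.le, Nat.add_sub_cancel, hbx' k (by omega), hbx' (k + 1 + 1) (by omega)]
      have h1 := p.scale_succ_sub k
      have h2 := p.scale_succ_sub (k + 1)
      have h3 := p.exp_potential_succ (k + 1)
      rw [← h1, ← h2] at h3
      refine le_of_eq ?_
      field_simp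
      linear_combination -h3
    · rw [hbx y hy]
      have := hb0 (y - 1)
      have := hb0 (y + 1)
      positivity
  have hite : ∀ (f : ℕ → ℝ) z, b z ≤ f z → b z ≤ if z = x then 0 else f z := by
    intro f z hz
    split_ifs with h'
    · exact (hbx z h'.le).le
    · exact hz
  -- induction on the time horizon: `b ≤ 1`, and `b` is subharmonic for the killed walk
  have hn : ∀ n y, b y ≤ p.avoidProb x n y := by
    intro n
    induction n with
    | zero =>
      intro y
      rw [avoidProb_zero, hb, div_le_one hd]
      linarith [hle (max x y)]
    | succ n ih =>
      intro y
      have hp0 : (0 : ℝ) < p y := (p y).2.1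
      have hp1 : (0 : ℝ) < 1 - p y := sub_pos.2 (p y).2.2
      rw [avoidProb_succ]
      refine (hb_sub y).trans (add_le_add ?_ ?_)
      · exact mul_le_mul_of_nonneg_left (hite _ _ (ih _)) hp0.le
      · exact mul_le_mul_of_nonneg_left (hite _ _ (ih _)) hp1.le
  have hesc : ∀ y, b y ≤ p.escapeProb x y := fun y =>
    ge_of_tendsto' (p.tendsto_avoidProb x y) fun n => hn n y
  have hp0 : (0 : ℝ) < p x := (p x).2.1
  have hp1 : (0 : ℝ) < 1 - p x := sub_pos.2 (p x).2.2
  rw [escapeProb_eq]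
  have h1 : 0 ≤ (if x - 1 = x then 0 else p.escapeProb x (x - 1)) := by
    split_ifs
    · exact le_rfl
    · exact (p.escapeProb_mem _ _).1
  have h2 : 0 < b (x + 1) := by
    rw [hbx' _ (by omega)]
    exact div_pos (sub_pos.2 (p.strictMono_scale (Nat.lt_succ_self x))) hd
  rw [if_neg (by omega : ¬ x + 1 = x)]
  have h3 := h2.trans_le (hesc (x + 1))
  positivity

end RWEnvironment

/-! ### Independence, and a zero-one law for exponential series -/

/-- If two independent sequences each consist of independent variables, then the pairs of their
terms are independent. -/
theorem iIndepFun_prodMk_of_indepFun {Ω : Type*} [MeasurableSpace Ω] {P : Measure Ω}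
    {X Y : ℕ → Ω → ℝ} (hX : ∀ n, Measurable (X n)) (hY : ∀ n, Measurable (Y n))
    (hXi : iIndepFun X P) (hYi : iIndepFun Y P)
    (hXY : IndepFun (fun w n => X n w) (fun w n => Y n w) P) :
    iIndepFun (fun n w => (X n w, Y n w)) P := by
  have hbox : ∀ (s : Finset ℕ) (A B : ℕ → Set ℝ), (∀ i ∈ s, MeasurableSet (A i)) →
      (∀ i ∈ s, MeasurableSet (B i)) →
      P (⋂ i ∈ s, X i ⁻¹' A i ∩ Y i ⁻¹' B i) =
        (∏ i ∈ s, P (X i ⁻¹' A i)) * ∏ i ∈ s, P (Y i ⁻¹' B i) := by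
    intro s A B hA hB
    have hset : ∀ (Z : ℕ → Ω → ℝ) (C : ℕ → Set ℝ), ⋂ i ∈ s, Z i ⁻¹' C i =
        (fun w n => Z n w) ⁻¹' (⋂ i ∈ s, (fun f : ℕ → ℝ => f i) ⁻¹' C i) := by
      intro Z C; ext w; simp
    have hmeas : ∀ C : ℕ → Set ℝ, (∀ i ∈ s, MeasurableSet (C i)) →
        MeasurableSet (⋂ i ∈ s, (fun f : ℕ → ℝ => f i) ⁻¹' C i) := fun C hC =>
      Finset.measurableSet_biInter s fun i hi => measurable_pi_apply i (hC i hi)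
    simp_rw [Set.iInter_inter_distrib]
    rw [← hXi.measure_inter_preimage_eq_mul s hA, ← hYi.measure_inter_preimage_eq_mul s hB,
      hset X A, hset Y B]
    exact hXY.measure_inter_preimage_eq_mul _ _ (hmeas A hA) (hmeas B hB)
  have hprod : ∀ i (A B : Set ℝ), MeasurableSet A → MeasurableSet B →
      P (X i ⁻¹' A ∩ Y i ⁻¹' B) = P (X i ⁻¹' A) * P (Y i ⁻¹' B) := by
    intro i A B hA hB
    simpa using hbox {i} (fun _ => A) (fun _ => B) (fun _ _ => hA) (fun _ _ => hB)
  refine iIndepSets.iIndep (fun n => ((hX n).prodMk (hY n)).comap_le)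
    (fun n => Set.preimage (fun w => (X n w, Y n w)) ''
      Set.image2 (· ×ˢ ·) {s : Set ℝ | MeasurableSet s} {t : Set ℝ | MeasurableSet t})
    (fun n => isPiSystem_prod.comap _) (fun n => ?_) ?_
  · rw [← MeasurableSpace.comap_generateFrom, generateFrom_prod]
  · rw [iIndepSets_iff]
    intro s f hf
    have h : ∀ i, ∃ A B : Set ℝ, i ∈ s →
        MeasurableSet A ∧ MeasurableSet B ∧ f i = X i ⁻¹' A ∩ Y i ⁻¹' B := by
      intro i
      by_cases hi : i ∈ s
      · obtain ⟨_, ⟨A, hA, B, hB, rfl⟩, hfi⟩ := hf i hi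
        exact ⟨A, B, fun _ => ⟨hA, hB, hfi.symm⟩⟩
      · exact ⟨∅, ∅, fun h => absurd h hi⟩
    choose A B hAB using h
    rw [Set.iInter₂_congr (fun i hi => (hAB i hi).2.2), hbox s A B (fun i hi => (hAB i hi).1)
      (fun i hi => (hAB i hi).2.1), ← Finset.prod_mul_distrib]
    refine Finset.prod_congr rfl fun i hi => ?_
    rw [(hAB i hi).2.2, hprod i _ _ (hAB i hi).1 (hAB i hi).2.1]

/-- Divergence of `∑ exp (U 0 + ⋯ + U (n - 1))` depends only on the tail of `U`. -/
theorem measurableSet_not_summable_exp_sum_tail {Ω : Type*} (U : ℕ → Ω → ℝ) :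
    MeasurableSet[Filter.limsup (fun n => MeasurableSpace.comap (U n) inferInstance) Filter.atTop]
      {w | ¬ Summable fun n => Real.exp (∑ j ∈ Finset.range n, U j w)} := by
  rw [Filter.limsup_eq_iInf_iSup_of_nat', MeasurableSpace.measurableSet_iInf]
  intro N
  -- dropping the first `N` variables multiplies the terms of index at least `N` by a constant
  have hiff : ∀ w, (Summable fun n => Real.exp (∑ j ∈ Finset.range n, U j w)) ↔
      Summable fun n => Real.exp (∑ j ∈ Finset.range n, U (j + N) w) := by
    intro w
    rw [← summable_nat_add_iff N, ← summable_mul_left_iff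
      (Real.exp_pos (∑ j ∈ Finset.range N, U j w)).ne' (f := fun n =>
        Real.exp (∑ j ∈ Finset.range n, U (j + N) w))]
    refine summable_congr fun n => ?_
    rw [← Real.exp_add, add_comm n N, Finset.sum_range_add]
    simp_rw [add_comm N]
  have htop : ∀ f : ℕ → ℝ, (∀ n, 0 ≤ f n) →
      (¬ Summable f ↔ ∑' n, ENNReal.ofReal (f n) = ⊤) := by
    intro f hf
    refine ⟨fun h => ?_, fun h h' => h'.tsum_ofReal_ne_top h⟩
    by_contra hne
    refine h ?_
    have := ENNReal.summable_toReal hne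
    simpa only [ENNReal.toReal_ofReal (hf _)] using this
  have hset : {w | ¬ Summable fun n => Real.exp (∑ j ∈ Finset.range n, U j w)} =
      (fun w => ∑' n, ENNReal.ofReal (Real.exp (∑ j ∈ Finset.range n, U (j + N) w))) ⁻¹' {⊤} := by
    ext w
    rw [Set.mem_ofPred_eq, hiff, htop _ fun n => (Real.exp_pos _).le]
    rfl
  rw [hset]
  let _ : MeasurableSpace Ω := ⨆ i, MeasurableSpace.comap (U (i + N)) inferInstance
  have hU : ∀ j, Measurable (U (j + N)) := fun j =>
    measurable_iff_comap_le.2 (le_iSup (fun i => MeasurableSpace.comap (U (i + N)) inferInstance) j)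
  exact (Measurable.tsum fun n => (Real.measurable_exp.comp
    (Finset.measurable_sum _ fun j _ => hU j)).ennreal_ofReal) (MeasurableSet.singleton ⊤)

open Filter Topology in
/-- If the partial sums of independent variables are nonnegative with probability bounded below,
then almost surely the exponentials of the partial sums are not summable. -/
theorem ae_not_summable_exp_sum {Ω : Type*} [MeasurableSpace Ω] {P : Measure Ω}
    [IsProbabilityMeasure P] {U : ℕ → Ω → ℝ} (hU : ∀ n, Measurable (U n)) (hi : iIndepFun U P)
    {θ : ENNReal} (hθ : 0 < θ)
    (h : ∀ᶠ n in atTop, θ ≤ P {w | 0 ≤ ∑ j ∈ Finset.range n, U j w}) :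
    ∀ᵐ w ∂P, ¬ Summable fun n => Real.exp (∑ j ∈ Finset.range n, U j w) := by
  set A := {w | ¬ Summable fun n => Real.exp (∑ j ∈ Finset.range n, U j w)} with hA
  have htail := measurableSet_not_summable_exp_sum_tail U
  have hle : ∀ n, MeasurableSpace.comap (U n) inferInstance ≤ ‹MeasurableSpace Ω› :=
    fun n => (hU n).comap_le
  have hAm : MeasurableSet A :=
    (limsup_le_iSup.trans (iSup_le hle)) _ htail
  have h01 := measure_zero_or_one_of_measurableSet_limsup_atTop hle hi htail
  have hpos : P A ≠ 0 := by
    intro h0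
    -- a convergent series has terms below `1` eventually, hence negative partial sums of `U`
    have hsub : (⋂ N : ℕ, ⋃ n ≥ N, {w | 0 ≤ ∑ j ∈ Finset.range n, U j w}) ⊆ A := by
      intro w hw hs
      have h1 := hs.tendsto_atTop_zero.eventually (gt_mem_nhds one_pos)
      obtain ⟨N, hN⟩ := eventually_atTop.1 h1
      obtain ⟨n, hn, hw'⟩ := Set.mem_iUnion₂.1 (Set.mem_iInter.1 hw N)
      exact absurd (hN n hn) (not_lt.2 (Real.one_le_exp hw'))
    have hm : ∀ N : ℕ, MeasurableSet (⋃ n ≥ N, {w | 0 ≤ ∑ j ∈ Finset.range n, U j w}) := fun N =>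
      MeasurableSet.iUnion fun n => MeasurableSet.iUnion fun _ =>
        measurableSet_le measurable_const (Finset.measurable_sum _ fun j _ => hU j)
    have hlim := tendsto_measure_iInter_atTop (μ := P) (fun N => (hm N).nullMeasurableSet)
      (fun M N hMN => Set.biUnion_subset_biUnion_left fun n hn => hMN.trans hn)
      ⟨0, measure_ne_top _ _⟩
    have hθle : θ ≤ P (⋂ N : ℕ, ⋃ n ≥ N, {w | 0 ≤ ∑ j ∈ Finset.range n, U j w}) := by
      refine ge_of_tendsto hlim ?_
      filter_upwards [h] with N hN
      exact hN.trans (measure_mono (Set.subset_biUnion_of_mem (u := fun n =>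
        {w | 0 ≤ ∑ j ∈ Finset.range n, U j w}) (le_refl N)))
    exact absurd (hθle.trans ((measure_mono hsub).trans h0.le)) (not_le.2 hθ)
  exact (mem_ae_iff_prob_eq_one hAm).2 (h01.resolve_left hpos)

/-! ### Fluctuations of sums of independent variables -/

open Filter Topology in
/-- Sums of i.i.d. centred square-integrable nondegenerate variables, perturbed by an error that
is `o(√n)` in `L¹`, are nonnegative with probability bounded below, by the central limit theorem. -/
theorem exists_le_measure_sum_add_nonneg {Ω : Type*} [MeasurableSpace Ω] {P : Measure Ω}
    [IsProbabilityMeasure P] {ζ : ℕ → Ω → ℝ} (hi : iIndepFun ζ P)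
    (hid : ∀ n, IdentDistrib (ζ n) (ζ 0) P P) (h2 : MemLp (ζ 0) 2 P) (h0 : ∫ w, ζ 0 w ∂P = 0)
    (hv : 0 < Var[ζ 0; P]) {D : ℕ → Ω → ℝ} (hD : ∀ n, Measurable (D n))
    (hDi : ∀ n, Integrable (D n) P)
    (hDlim : Tendsto (fun n : ℕ => (∫ w, |D n w| ∂P) / √n) atTop (𝓝 0)) :
    ∃ θ : ENNReal, 0 < θ ∧
      ∀ᶠ n in atTop, θ ≤ P {w | 0 ≤ ∑ j ∈ Finset.range n, ζ j w + D n w} := by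
  have hY : HasLaw (id : ℝ → ℝ) (gaussianReal 0 Var[ζ 0; P].toNNReal)
      (gaussianReal 0 Var[ζ 0; P].toNNReal) := HasLaw.id
  have hclt := tendstoInDistribution_inv_sqrt_mul_sum_sub hY h2 hi hid
  simp only [h0, mul_zero, sub_zero] at hclt
  have hζm : ∀ n, AEMeasurable (ζ n) P := fun n => (hid n).aemeasurable_fst
  have hsl := tendstoInDistribution_of_tendstoInMeasure_sub
    (fun (n : ℕ) w => (√n)⁻¹ * (∑ j ∈ Finset.range n, ζ j w + D n w)) id hclt ?_
    (fun n => ((Finset.aemeasurable_fun_sum _ fun j _ => hζm j).add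
      (hD n).aemeasurable).const_mul _)
  · have hG : IsOpen (Set.Ioi (0 : ℝ)) := isOpen_Ioi
    have hopen := ProbabilityMeasure.le_liminf_measure_open_of_tendsto hsl.tendsto hG
    simp only [ProbabilityMeasure.coe_mk, Measure.map_id] at hopen
    have hne : Var[ζ 0; P].toNNReal ≠ 0 := by simpa using hv
    have hgpos : 0 < gaussianReal 0 Var[ζ 0; P].toNNReal (Set.Ioi 0) := by
      refine pos_iff_ne_zero.2 fun hz => ?_
      have := gaussianReal_absolutelyContinuous' 0 hne hz
      simp at this
    obtain ⟨θ, hθ0, hθ⟩ := exists_between hgpos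
    refine ⟨θ, hθ0, ?_⟩
    filter_upwards [eventually_lt_of_lt_liminf (hθ.trans_le hopen)] with n hn
    refine hn.le.trans ?_
    rw [Measure.map_apply_of_aemeasurable (hsl.forall_aemeasurable n) measurableSet_Ioi]
    refine measure_mono fun w hw => ?_
    have hw' : 0 < (√(n : ℝ))⁻¹ * (∑ j ∈ Finset.range n, ζ j w + D n w) := hw
    exact (pos_of_mul_pos_right hw' (by positivity)).le
  · refine tendstoInMeasure_of_tendsto_eLpNorm one_ne_zero (fun n => ?_)
      aestronglyMeasurable_const ?_
    · exact (((Finset.aemeasurable_fun_sum _ fun j _ => hζm j).add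
        (hD n).aemeasurable).const_mul _ |>.sub ((Finset.aemeasurable_fun_sum _ fun j _ =>
          hζm j).const_mul _)).aestronglyMeasurable
    · have hcongr : ∀ n : ℕ, eLpNorm ((fun w => (√(n : ℝ))⁻¹ * (∑ j ∈ Finset.range n, ζ j w + D n w))
          - (fun w => (√(n : ℝ))⁻¹ * ∑ j ∈ Finset.range n, ζ j w) - 0) 1 P =
          ENNReal.ofReal ((∫ w, |D n w| ∂P) / √n) := by
        intro n
        have : ((fun w => (√(n : ℝ))⁻¹ * (∑ j ∈ Finset.range n, ζ j w + D n w))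
          - (fun w => (√(n : ℝ))⁻¹ * ∑ j ∈ Finset.range n, ζ j w) - 0) =
            fun w => (√(n : ℝ))⁻¹ * D n w := by
          ext w; simp; ring
        rw [this, eLpNorm_one_eq_lintegral_enorm, ← ofReal_integral_norm_eq_lintegral_enorm
          ((hDi n).const_mul _)]
        congr 1
        simp_rw [norm_mul]
        rw [integral_const_mul, Real.norm_of_nonneg (by positivity)]
        simp [div_eq_inv_mul]
      have := ENNReal.tendsto_ofReal hDlim
      rw [ENNReal.ofReal_zero] at this
      exact this.congr fun n => (hcongr n).symm

/-- Abel summation: if the partial sums of `y k / (k + 1) ^ γ` are bounded, the partial sums of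
`y` grow at most like `n ^ γ`. -/
theorem abs_sum_le_of_abs_weighted_sum_le {y : ℕ → ℝ} {γ B : ℝ} (hγ : 0 < γ)
    (hB : ∀ n, |∑ k ∈ Finset.range n, ((k + 1 : ℕ) : ℝ) ^ (-γ) * y k| ≤ B) (n : ℕ) :
    |∑ k ∈ Finset.range n, y k| ≤ 2 * B * (n : ℝ) ^ γ := by
  set M : ℕ → ℝ := fun n => ∑ k ∈ Finset.range n, ((k + 1 : ℕ) : ℝ) ^ (-γ) * y k with hM
  -- the difference increases by `-((n + 1) ^ γ - n ^ γ) * M n` at step `n`, which telescopes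
  have h : ∀ n : ℕ, |∑ k ∈ Finset.range n, y k - (n : ℝ) ^ γ * M n| ≤ B * (n : ℝ) ^ γ := by
    intro n
    induction n with
    | zero => simp [hM, Real.zero_rpow hγ.ne']
    | succ n ih =>
      have hmono : (n : ℝ) ^ γ ≤ ((n + 1 : ℕ) : ℝ) ^ γ :=
        Real.rpow_le_rpow (by positivity) (by push_cast; linarith) hγ.le
      have hpos : (0 : ℝ) < ((n + 1 : ℕ) : ℝ) := by positivity
      have hMs : ((n + 1 : ℕ) : ℝ) ^ γ * M (n + 1) = ((n + 1 : ℕ) : ℝ) ^ γ * M n + y n := by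
        simp only [hM, Finset.sum_range_succ]
        rw [mul_add, ← mul_assoc (((n + 1 : ℕ) : ℝ) ^ γ) (((n + 1 : ℕ) : ℝ) ^ (-γ)),
          ← Real.rpow_add hpos]
        simp
      have heq : ∑ k ∈ Finset.range (n + 1), y k - ((n + 1 : ℕ) : ℝ) ^ γ * M (n + 1) =
          (∑ k ∈ Finset.range n, y k - (n : ℝ) ^ γ * M n) -
            (((n + 1 : ℕ) : ℝ) ^ γ - (n : ℝ) ^ γ) * M n := by
        rw [hMs, Finset.sum_range_succ]; ring
      rw [heq]
      refine (abs_sub _ _).trans ?_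
      rw [abs_mul, abs_of_nonneg (sub_nonneg.2 hmono)]
      have := mul_le_mul_of_nonneg_left (hB n) (sub_nonneg.2 hmono)
      linarith
  have h1 := h n
  have hn : (0 : ℝ) ≤ (n : ℝ) ^ γ := by positivity
  have h2 : |(n : ℝ) ^ γ * M n| ≤ (n : ℝ) ^ γ * B := by
    rw [abs_mul, abs_of_nonneg hn]; exact mul_le_mul_of_nonneg_left (hB n) hn
  rw [abs_le] at *
  constructor <;> linarith

open Filter Topology in
/-- The partial sums of independent centred variables with bounded variances are almost surely
`O(n ^ γ)` for `γ > 1 / 2`: the martingale `∑ Y k / (k + 1) ^ γ` is bounded in `L²`, hence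
converges, and Abel summation applies. -/
theorem ae_exists_abs_sum_le {Ω : Type*} [MeasurableSpace Ω] {P : Measure Ω}
    [IsProbabilityMeasure P] {Y : ℕ → Ω → ℝ} (hY : ∀ n, Measurable (Y n)) (hi : iIndepFun Y P)
    (h2 : ∀ n, MemLp (Y n) 2 P) (h0 : ∀ n, ∫ w, Y n w ∂P = 0) {K : ℝ}
    (hK : ∀ n, Var[Y n; P] ≤ K) {γ : ℝ} (hγ : 1 / 2 < γ) :
    ∀ᵐ w ∂P, ∃ B : ℝ, ∀ n : ℕ, |∑ k ∈ Finset.range n, Y k w| ≤ B * (n : ℝ) ^ γ := by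
  set Z : ℕ → Ω → ℝ := fun k w => ((k + 1 : ℕ) : ℝ) ^ (-γ) * Y k w with hZ
  have hZm : ∀ k, Measurable (Z k) := fun k => (hY k).const_mul _
  have hZs : ∀ k, StronglyMeasurable (Z k) := fun k => (hZm k).stronglyMeasurable
  have hZi : iIndepFun Z P :=
    hi.comp (fun k x => ((k + 1 : ℕ) : ℝ) ^ (-γ) * x) fun k => by fun_prop
  have hZ2 : ∀ k, MemLp (Z k) 2 P := fun k => (h2 k).const_mul _
  have hZ0 : ∀ k, ∫ w, Z k w ∂P = 0 := fun k => by simp [hZ, integral_const_mul, h0]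
  have hZint : ∀ k, Integrable (Z k) P := fun k => (hZ2 k).integrable (by norm_num)
  set ℱ := Filtration.natural Z hZs with hℱ
  set M : ℕ → Ω → ℝ := fun n => ∑ k ∈ Finset.range (n + 1), Z k with hM
  have hM2 : ∀ n, MemLp (M n) 2 P := fun n => memLp_finsetSum' _ fun k _ => hZ2 k
  have hMint : ∀ n, Integrable (M n) P := fun n => (hM2 n).integrable (by norm_num)
  have hmart : Martingale M ℱ P := by
    refine martingale_of_condExp_sub_eq_zero_nat (fun n => ?_) hMint fun n => ?_
    · refine Finset.stronglyMeasurable_sum _ fun k hk => ?_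
      exact ((Filtration.stronglyAdapted_natural hZs) k).mono
        (ℱ.mono (Nat.lt_succ_iff.1 (Finset.mem_range.1 hk)))
    · have : M (n + 1) - M n = Z (n + 1) := by simp [hM, Finset.sum_range_succ _ (n + 1)]
      rw [this]
      refine (hZi.condExp_natural_ae_eq_of_lt hZs (Nat.lt_succ_self n)).trans ?_
      rw [hZ0]; rfl
  have hsum : Summable fun k : ℕ => ((k + 1 : ℕ) : ℝ) ^ (-(2 * γ)) :=
    (summable_nat_add_iff (f := fun k : ℕ => (k : ℝ) ^ (-(2 * γ))) 1).2
      (Real.summable_nat_rpow.2 (by linarith))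
  have hK0 : 0 ≤ K := (variance_nonneg _ _).trans (hK 0)
  have hvar : ∀ n, ∫ w, (M n w) ^ 2 ∂P ≤ K * ∑' k : ℕ, ((k + 1 : ℕ) : ℝ) ^ (-(2 * γ)) := by
    intro n
    have hM0 : ∫ w, M n w ∂P = 0 := by
      simp only [hM, Finset.sum_apply]
      rw [integral_finsetSum _ fun k _ => hZint k]
      simp [hZ0]
    rw [← variance_of_integral_eq_zero (hM2 n).aemeasurable hM0]
    simp only [hM]
    rw [IndepFun.variance_sum (fun k _ => hZ2 k) fun i _ j _ hij => hZi.indepFun hij]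
    calc ∑ k ∈ Finset.range (n + 1), Var[Z k; P]
        ≤ ∑ k ∈ Finset.range (n + 1), K * ((k + 1 : ℕ) : ℝ) ^ (-(2 * γ)) := by
          refine Finset.sum_le_sum fun k _ => ?_
          have hk : (0 : ℝ) ≤ ((k + 1 : ℕ) : ℝ) := by positivity
          simp only [hZ]
          rw [variance_const_mul, mul_comm K, ← Real.rpow_natCast, ← Real.rpow_mul hk]
          have : -γ * ((2 : ℕ) : ℝ) = -(2 * γ) := by push_cast; ring
          rw [this]
          exact mul_le_mul_of_nonneg_left (hK k) (by positivity)
      _ = K * ∑ k ∈ Finset.range (n + 1), ((k + 1 : ℕ) : ℝ) ^ (-(2 * γ)) := by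
          rw [Finset.mul_sum]
      _ ≤ _ := mul_le_mul_of_nonneg_left
          (hsum.sum_le_tsum (Finset.range (n + 1)) fun k _ => by positivity) hK0
  set R : ℝ := 1 + K * ∑' k : ℕ, ((k + 1 : ℕ) : ℝ) ^ (-(2 * γ)) with hR
  have hbdd : ∀ n, eLpNorm (M n) 1 P ≤ (R.toNNReal : ENNReal) := by
    intro n
    rw [eLpNorm_one_eq_lintegral_enorm, ← ofReal_integral_norm_eq_lintegral_enorm (hMint n)]
    refine ENNReal.ofReal_le_ofReal ?_
    calc ∫ w, ‖M n w‖ ∂P ≤ ∫ w, (1 + (M n w) ^ 2) ∂P := by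
          refine integral_mono (hMint n).norm ((integrable_const _).add (hM2 n).integrable_sq)
            fun w => ?_
          simp only [Real.norm_eq_abs]
          nlinarith [sq_abs (M n w), sq_nonneg (|M n w| - 1), abs_nonneg (M n w)]
      _ = 1 + ∫ w, (M n w) ^ 2 ∂P := by
          rw [integral_add (integrable_const _) (hM2 n).integrable_sq]; simp
      _ ≤ R := by rw [hR]; linarith [hvar n]
  filter_upwards [hmart.submartingale.ae_tendsto_limitProcess hbdd] with w hw
  simp only [hM, Finset.sum_apply] at hw
  have hw' := (tendsto_add_atTop_iff_nat (f := fun n => ∑ k ∈ Finset.range n, Z k w) 1).1 hw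
  obtain ⟨B, hB⟩ := hw'.abs.bddAbove_range
  exact ⟨2 * B, abs_sum_le_of_abs_weighted_sum_le (by linarith) fun n => hB ⟨n, rfl⟩⟩

/-! ### Growth of the cumulated frequency of the perturbed sites -/

open Filter Asymptotics in
theorem isLittleO_natCast_rpow_rpow {γ s : ℝ} (h : γ < s) :
    (fun n : ℕ => (n : ℝ) ^ γ) =o[atTop] fun n : ℕ => (n : ℝ) ^ s := by
  refine IsLittleO.comp_tendsto (k := fun n : ℕ => (n : ℝ)) (f := fun x : ℝ => x ^ γ)
    (g := fun x : ℝ => x ^ s) ?_ tendsto_natCast_atTop_atTop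
  refine (isLittleO_iff_tendsto' ?_).2 ?_
  · filter_upwards [eventually_gt_atTop 0] with x hx h0
    exact absurd h0 (Real.rpow_pos_of_pos hx s).ne'
  · refine (tendsto_rpow_neg_atTop (sub_pos.2 h)).congr' ?_
    filter_upwards [eventually_gt_atTop 0] with x hx
    rw [neg_sub, Real.rpow_sub hx]

theorem le_sum_of_eq_rpow_neg {φ : ℕ → ℝ} {β : ℝ} (hβ : 0 < β) (h0 : 0 ≤ φ 0)
    (hφ : ∀ n : ℕ, 1 ≤ n → φ n = (n : ℝ) ^ (-β)) {n : ℕ} (hn : 2 ≤ n) :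
    (n : ℝ) ^ (1 - β) / 2 ≤ ∑ k ∈ Finset.range n, φ k := by
  obtain ⟨m, rfl⟩ : ∃ m, n = m + 1 := ⟨n - 1, by omega⟩
  have hpos : (0 : ℝ) < ((m + 1 : ℕ) : ℝ) := by positivity
  have hm : (1 : ℝ) ≤ m := by exact_mod_cast (by omega : 1 ≤ m)
  rw [Finset.sum_range_succ']
  have h1 : ∑ _k ∈ Finset.range m, ((m + 1 : ℕ) : ℝ) ^ (-β) ≤
      ∑ k ∈ Finset.range m, φ (k + 1) := by
    refine Finset.sum_le_sum fun k hk => ?_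
    rw [hφ _ (by omega)]
    refine Real.rpow_le_rpow_of_nonpos (by positivity) ?_ (by linarith)
    exact_mod_cast Nat.succ_le_succ (Finset.mem_range.1 hk).le
  rw [Finset.sum_const, Finset.card_range, nsmul_eq_mul] at h1
  have h2 : ((m + 1 : ℕ) : ℝ) ^ (1 - β) = ((m + 1 : ℕ) : ℝ) * ((m + 1 : ℕ) : ℝ) ^ (-β) := by
    rw [sub_eq_add_neg, Real.rpow_add hpos, Real.rpow_one]
  have h3 : (0 : ℝ) < ((m + 1 : ℕ) : ℝ) ^ (-β) := by positivity
  rw [h2]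
  have h4 : ((m + 1 : ℕ) : ℝ) / 2 ≤ m := by push_cast; linarith
  nlinarith [mul_le_mul_of_nonneg_right h4 h3.le]

open Filter Topology Asymptotics in
/-- Summing `n ^ (-β) = o(n ^ (-1/2))`, where `n ^ (-1/2)` is comparable to the increments of the
square root. -/
theorem isLittleO_sum_sqrt {φ : ℕ → ℝ} {β : ℝ} (hβ : 1 / 2 < β)
    (hφ : ∀ n : ℕ, 1 ≤ n → φ n = (n : ℝ) ^ (-β)) :
    (fun n => ∑ k ∈ Finset.range n, φ k) =o[atTop] fun n : ℕ => √(n : ℝ) := by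
  have hg : ∀ n : ℕ, √(n : ℝ) = ∑ k ∈ Finset.range n, (√((k + 1 : ℕ) : ℝ) - √(k : ℝ)) := by
    intro n
    rw [Finset.sum_range_sub (fun k : ℕ => √(k : ℝ))]; simp
  rw [funext hg]
  refine IsLittleO.sum_range ?_ (fun n => ?_) ?_
  · have h1 : (fun n : ℕ => (n : ℝ) ^ (-β)) =o[atTop] fun n : ℕ => (n : ℝ) ^ (-(1 / 2) : ℝ) :=
      isLittleO_natCast_rpow_rpow (by linarith)
    have h2 : (fun n : ℕ => (n : ℝ) ^ (-(1 / 2) : ℝ)) =O[atTop]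
        fun n : ℕ => √((n + 1 : ℕ) : ℝ) - √(n : ℝ) := by
      refine IsBigO.of_bound 3 ?_
      filter_upwards [eventually_ge_atTop 1] with n hn
      have hn' : (1 : ℝ) ≤ n := by exact_mod_cast hn
      have ha : 0 < √(n : ℝ) := Real.sqrt_pos.2 (by linarith)
      have hb := Real.sq_sqrt (by linarith : (0 : ℝ) ≤ n)
      have hc := Real.sq_sqrt (by positivity : (0 : ℝ) ≤ ((n + 1 : ℕ) : ℝ))
      have hle : √(n : ℝ) ≤ √((n + 1 : ℕ) : ℝ) := Real.sqrt_le_sqrt (by push_cast; linarith)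
      have hle2 : √((n + 1 : ℕ) : ℝ) ≤ 2 * √(n : ℝ) := by
        refine Real.sqrt_le_iff.2 ⟨by positivity, ?_⟩
        push_cast; nlinarith
      rw [Real.norm_of_nonneg (by positivity), Real.norm_of_nonneg (sub_nonneg.2 hle),
        Real.rpow_neg (by positivity), ← Real.sqrt_eq_rpow, inv_le_iff_one_le_mul₀ ha]
      push_cast at hc
      push_cast at hle hle2 ⊢
      nlinarith
    refine (h1.trans_isBigO h2).congr' ?_ EventuallyEq.rfl
    filter_upwards [eventually_ge_atTop 1] with n hn
    rw [hφ n hn]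
  · exact sub_nonneg.2 (Real.sqrt_le_sqrt (by push_cast; linarith))
  · simp_rw [← hg]
    exact Real.tendsto_sqrt_atTop.comp tendsto_natCast_atTop_atTop

open Filter in
theorem eventually_mul_rpow_le {γ s : ℝ} (h : γ < s) (B : ℝ) {a : ℝ} (ha : 0 < a) :
    ∀ᶠ n : ℕ in atTop, B * (n : ℝ) ^ γ ≤ a * (n : ℝ) ^ s := by
  have h1 := (isLittleO_natCast_rpow_rpow h).const_mul_left B
  filter_upwards [h1.bound ha] with n hn
  refine (le_abs_self _).trans ?_
  simpa [abs_of_nonneg (Real.rpow_nonneg (Nat.cast_nonneg n) s)] using hn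

open Filter Asymptotics in
theorem summable_exp_neg_mul_rpow {a s : ℝ} (ha : 0 < a) (hs : 0 < s) :
    Summable fun n : ℕ => Real.exp (-a * (n : ℝ) ^ s) := by
  have h := (isLittleO_exp_neg_mul_rpow_atTop ha (-2 / s)).comp_tendsto
    ((tendsto_rpow_atTop hs).comp tendsto_natCast_atTop_atTop)
  refine summable_of_isBigO_nat (Real.summable_nat_rpow.2 (by norm_num : (-2 : ℝ) < -1))
    (h.isBigO.congr (fun _ => rfl) fun n => ?_)
  simp only [Function.comp_apply]
  rw [← Real.rpow_mul (Nat.cast_nonneg n), mul_div_cancel₀ _ hs.ne']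

/-- A real variable whose tails `P (Z ≤ -x)` and `P (x ≤ Z)` agree for `x ≥ 0` is centred. -/
theorem integral_eq_zero_of_symm_tails {Ω : Type*} [MeasurableSpace Ω] {P : Measure Ω} {Z : Ω → ℝ}
    (hm : Measurable Z) (hZ : Integrable Z P)
    (hS : ∀ x : ℝ, 0 ≤ x → P {w | Z w ≤ -x} = P {w | x ≤ Z w}) : ∫ w, Z w ∂P = 0 := by
  -- the positive part of any `f` has layers `{t ≤ f}` at the levels `t > 0`
  have hlayer : ∀ f : Ω → ℝ, Measurable f → ∫⁻ w, ENNReal.ofReal (f w) ∂P =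
      ∫⁻ t in Set.Ioi 0, P {w | t ≤ f w} := by
    intro f hf
    have h := lintegral_eq_lintegral_meas_le P (f := fun w => max (f w) 0)
      (Filter.Eventually.of_forall fun w => le_max_right _ _) (hf.max measurable_const).aemeasurable
    rw [setLIntegral_congr_fun (g := fun t => P {w | t ≤ f w}) measurableSet_Ioi ?_] at h
    · rw [← h]
      refine lintegral_congr fun w => ?_
      rcases le_total (f w) 0 with hw | hw <;> simp [hw, ENNReal.ofReal_of_nonpos]
    · intro t ht
      have ht' : ¬ t ≤ 0 := not_le.2 ht
      simp [ht']
  rw [integral_eq_lintegral_pos_part_sub_lintegral_neg_part hZ, hlayer Z hm,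
    hlayer (fun w => -Z w) hm.neg, setLIntegral_congr_fun (g := fun t => P {w | t ≤ Z w})
      (f := fun t => P {w | t ≤ -Z w}) measurableSet_Ioi, sub_self]
  intro t ht
  simp only
  rw [← hS t (le_of_lt ht)]
  congr 1
  ext w
  exact le_neg (a := t) (b := Z w)

/-! ### The random potential -/

theorem tendsto_integral_abs_sum_div_sqrt {Ω : Type*} [MeasurableSpace Ω] {P : Measure Ω}
    {F : ℕ → Ω → ℝ} (hF : ∀ k, Integrable (F k) P) {φ : ℕ → ℝ} {C : ℝ}
    (hC : ∀ k, ∫ w, |F k w| ∂P = C * φ k)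
    (hφ : (fun n => ∑ k ∈ Finset.range n, φ k) =o[Filter.atTop] fun n : ℕ => √(n : ℝ)) :
    Filter.Tendsto (fun n : ℕ => (∫ w, |∑ k ∈ Finset.range n, F k w| ∂P) / √n)
      Filter.atTop (nhds 0) := by
  have h1 : Filter.Tendsto (fun n : ℕ => C * ((∑ k ∈ Finset.range n, φ k) / √n))
      Filter.atTop (nhds 0) := by
    simpa using hφ.tendsto_div_nhds_zero.const_mul C
  refine squeeze_zero (fun n => by positivity) (fun n => ?_) h1
  rw [← mul_div_assoc]
  refine div_le_div_of_nonneg_right ?_ (by positivity)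
  calc ∫ w, |∑ k ∈ Finset.range n, F k w| ∂P
      ≤ ∫ w, ∑ k ∈ Finset.range n, |F k w| ∂P :=
        integral_mono (integrable_finsetSum _ fun k _ => hF k).abs
          (integrable_finsetSum _ fun k _ => (hF k).abs) fun w => Finset.abs_sum_le_sum_abs _ _
    _ = C * ∑ k ∈ Finset.range n, φ k := by
        rw [integral_finsetSum _ fun k _ => (hF k).abs, Finset.mul_sum]
        exact Finset.sum_congr rfl fun k _ => hC k

/-- A drift `c * Φ n` with `c > 0` and `Φ n ≥ n ^ s / 2` dominates fluctuations of order `n ^ γ`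
with `γ < s`, so the exponentials do not tend to zero. -/
theorem not_summable_exp_of_abs_sub_le {S Φ : ℕ → ℝ} {c B γ s : ℝ} (hc : 0 < c) (hγ : γ < s)
    (hΦ : ∀ n : ℕ, 2 ≤ n → (n : ℝ) ^ s / 2 ≤ Φ n)
    (hS : ∀ n : ℕ, |S n - c * Φ n| ≤ B * (n : ℝ) ^ γ) :
    ¬ Summable fun n => Real.exp (S n) := by
  intro h
  have h1 := h.tendsto_atTop_zero.eventually (gt_mem_nhds one_pos)
  obtain ⟨n, hn1, hn2, hn3⟩ := (h1.and ((eventually_mul_rpow_le hγ B (half_pos hc)).and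
    (Filter.eventually_ge_atTop 2))).exists
  have h4 := (abs_le.1 (hS n)).1
  have h5 := mul_le_mul_of_nonneg_left (hΦ n hn3) hc.le
  exact absurd hn1 (not_lt.2 (Real.one_le_exp (by linarith)))

/-- With `c < 0` the same domination gives the stretched exponential bound
`exp (S n) ≤ exp (c / 4 * n ^ s)` for large `n`. -/
theorem summable_exp_of_abs_sub_le {S Φ : ℕ → ℝ} {c B γ s : ℝ} (hc : c < 0) (hs : 0 < s)
    (hγ : γ < s) (hΦ : ∀ n : ℕ, 2 ≤ n → (n : ℝ) ^ s / 2 ≤ Φ n)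
    (hS : ∀ n : ℕ, |S n - c * Φ n| ≤ B * (n : ℝ) ^ γ) :
    Summable fun n => Real.exp (S n) := by
  have ha : 0 < -c / 4 := by linarith
  refine summable_of_isBigO_nat (summable_exp_neg_mul_rpow ha hs) (Asymptotics.IsBigO.of_bound 1 ?_)
  filter_upwards [eventually_mul_rpow_le hγ B ha, Filter.eventually_ge_atTop 2] with n hn hn2
  rw [Real.norm_of_nonneg (Real.exp_nonneg _), Real.norm_of_nonneg (Real.exp_nonneg _), one_mul]
  refine Real.exp_le_exp.2 ?_
  have h4 := (abs_le.1 (hS n)).2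
  have h5 := mul_le_mul_of_nonneg_left (hΦ n hn2) (neg_nonneg.2 hc.le)
  linarith

theorem theorem2 {Ω : Type*} [MeasurableSpace Ω] (P : Measure Ω) [IsProbabilityMeasure P]
    (δ β : ℝ) (hδ : δ ∈ Set.Ioo (-1 : ℝ) 1) (hβ : β ∈ Set.Ioo (0 : ℝ) 1)
    -- `φ n = n ^ (-β)` for `n ≥ 1`; the value `φ 0 ∈ [0, 1]` is arbitrary
    (φ : ℕ → ℝ) (hφ01 : ∀ n, φ n ∈ Set.Icc (0 : ℝ) 1)
    (hφ : ∀ n : ℕ, 1 ≤ n → φ n = (n : ℝ) ^ (-β))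
    -- independent `{0, 1}`-valued `χ n` with success probabilities `φ n`
    (χ : ℕ → Ω → ℝ) (hχ_meas : ∀ n, Measurable (χ n)) (hχ_val : ∀ n w, χ n w = 0 ∨ χ n w = 1)
    (hχ_prob : ∀ n, P.real {w | χ n w = 1} = φ n) (hχ_indep : iIndepFun χ P)
    -- i.i.d. `(0, 1)`-valued `ξ n`, independent of the `χ n`
    (ξ : ℕ → Ω → ℝ) (hξ_meas : ∀ n, Measurable (ξ n))
    (hξ_val : ∀ n w, ξ n w ∈ Set.Ioo (0 : ℝ) 1)
    (hξ_indep : iIndepFun ξ P) (hξ_ident : ∀ n, IdentDistrib (ξ n) (ξ 0) P P)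
    (hχξ : IndepFun (fun w n => χ n w) (fun w n => ξ n w) P)
    -- the random environment
    (p : Ω → RWEnvironment)
    (hp : ∀ w n, (p w n : ℝ) = (1 - δ) / 2 * χ n w + ξ n w * (1 - χ n w))
    -- the log-odds `ζ n`, with symmetric law and with second moment in `(0, ∞)`
    (ζ : ℕ → Ω → ℝ) (hζ : ∀ n w, ζ n w = Real.log (ξ n w / (1 - ξ n w)))
    (hS : ∀ x : ℝ, 0 ≤ x → P {w | ζ 0 w ≤ -x} = P {w | x ≤ ζ 0 w})
    (hζ_int : Integrable (fun w => ζ 0 w ^ 2) P) (hζ_pos : 0 < ∫ w, ζ 0 w ^ 2 ∂P) :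
    (β < 1 / 2 →
      (δ < 0 → ∀ᵐ w ∂P, (p w).IsRecurrent) ∧ (0 < δ → ∀ᵐ w ∂P, (p w).IsTransient)) ∧
    (1 / 2 < β → ∀ᵐ w ∂P, (p w).IsRecurrent) := by
  obtain ⟨hδ1, hδ2⟩ := hδ
  obtain ⟨hβ0, hβ1⟩ := hβ
  set c : ℝ := Real.log ((1 - δ) / 2 / (1 - (1 - δ) / 2)) with hc
  have hden : 0 < 1 - (1 - δ) / 2 := by linarith
  have hg : Measurable fun x : ℝ => Real.log (x / (1 - x)) := by fun_prop
  have hζeq : ∀ n, ζ n = (fun x => Real.log (x / (1 - x))) ∘ ξ n := fun n => funext (hζ n)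
  have hζm : ∀ n, Measurable (ζ n) := fun n => by rw [hζeq]; exact hg.comp (hξ_meas n)
  have hζi : iIndepFun ζ P := by
    rw [funext hζeq]; exact hξ_indep.comp (fun _ x => Real.log (x / (1 - x))) fun _ => hg
  have hζid : ∀ n, IdentDistrib (ζ n) (ζ 0) P P := fun n => by
    rw [hζeq, hζeq]; exact (hξ_ident n).comp hg
  have hζ2 : ∀ n, MemLp (ζ n) 2 P := fun n =>
    (hζid n).memLp_iff.2 ((memLp_two_iff_integrable_sq (hζm 0).aestronglyMeasurable).2 hζ_int)
  have hζint : ∀ n, Integrable (ζ n) P := fun n => (hζ2 n).integrable (by norm_num)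
  have hζmean : ∀ n, ∫ w, ζ n w ∂P = 0 := fun n => by
    rw [(hζid n).integral_eq]; exact integral_eq_zero_of_symm_tails (hζm 0) (hζint 0) hS
  have hχζ : ∀ n, IndepFun (χ n) (ζ n) P := fun n => by
    have he : Measurable fun f : ℕ → ℝ => f n := measurable_pi_apply n
    have h := hχξ.comp (φ := fun f : ℕ → ℝ => f n) (ψ := fun f : ℕ → ℝ => Real.log (f n / (1 - f n)))
      he (hg.comp he)
    rw [hζeq]; exact h
  have hχind : ∀ n, χ n = {w | χ n w = 1}.indicator 1 := fun n => by
    ext w; rcases hχ_val n w with h | h <;> simp [h]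
  have hχset : ∀ n, MeasurableSet {w | χ n w = 1} := fun n =>
    hχ_meas n (MeasurableSet.singleton 1)
  have hχmean : ∀ n, ∫ w, χ n w ∂P = φ n := fun n => by
    rw [← hχ_prob, ← integral_indicator_one (hχset n), ← hχind]
  have hχabs : ∀ n w, |χ n w| ≤ 1 := fun n w => by
    rcases hχ_val n w with h | h <;> simp [h]
  -- the perturbation replaces the step `ζ n` of the potential by the constant `c`
  set F : ℕ → Ω → ℝ := fun n w => χ n w * (c - ζ n w) with hF
  have hFm : ∀ n, Measurable (F n) := fun n => (hχ_meas n).mul ((hζm n).const_sub c)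
  have hFint : ∀ n, Integrable (F n) P := fun n =>
    ((integrable_const c).sub (hζint n)).bdd_mul (hχ_meas n).aestronglyMeasurable
      (Filter.Eventually.of_forall (hχabs n))
  have hFmean : ∀ n, ∫ w, F n w ∂P = c * φ n := fun n => by
    have hm : Measurable fun x : ℝ => c - x := by fun_prop
    have h := ((hχζ n).comp measurable_id hm).integral_fun_mul_eq_mul_integral
      (hχ_meas n).aestronglyMeasurable ((hζm n).const_sub c).aestronglyMeasurable
    simp only [Function.comp_apply, id] at h
    simp only [hF]
    rw [h, hχmean, integral_sub (integrable_const c) (hζint n), hζmean]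
    simp [mul_comm]
  have hFabs : ∀ n, ∫ w, |F n w| ∂P = (∫ w, |c - ζ 0 w| ∂P) * φ n := fun n => by
    have hm : Measurable fun x : ℝ => |c - x| := by fun_prop
    have h := ((hχζ n).comp measurable_id hm).integral_fun_mul_eq_mul_integral
      (hχ_meas n).aestronglyMeasurable (hm.comp (hζm n)).aestronglyMeasurable
    simp only [Function.comp_apply, id] at h
    have hid := ((hζid n).comp hm).integral_eq
    simp only [Function.comp_apply] at hid
    rw [← hid, mul_comm, ← hχmean, ← h]
    refine integral_congr_ae (Filter.Eventually.of_forall fun w => ?_)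
    rcases hχ_val n w with h' | h' <;> simp [hF, h']
  set U : ℕ → Ω → ℝ := fun n w => ζ n w + F n w with hU
  have hUm : ∀ n, Measurable (U n) := fun n => (hζm n).add (hFm n)
  have hUlog : ∀ n w, Real.log (p w n / (1 - p w n)) = U n w := fun n w => by
    rcases hχ_val n w with h | h
    · simp [hU, hF, hp, h, hζ]
    · simp [hU, hF, hp, h, hc]
  have hpot : ∀ w n, (p w).potential n = ∑ j ∈ Finset.range n, U j w := fun w n =>
    Finset.sum_congr rfl fun j _ => hUlog j w
  have hUi : iIndepFun U P := by
    have h := (iIndepFun_prodMk_of_indepFun hχ_meas hξ_meas hχ_indep hξ_indep hχξ).comp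
      (fun _ (q : ℝ × ℝ) => Real.log (q.2 / (1 - q.2)) +
        q.1 * (c - Real.log (q.2 / (1 - q.2)))) fun _ => by fun_prop
    refine (iIndepFun_congr fun n => Filter.Eventually.of_forall fun w => ?_).1 h
    simp [hU, hF, hζ]
  refine ⟨fun hβ2 => ?_, fun hβ2 => ?_⟩
  · -- fluctuations of order `n ^ γ` are smaller than the drift, of order `n ^ (1 - β)`
    obtain ⟨γ, hγ1, hγ2⟩ := exists_between (show 1 / 2 < 1 - β by linarith)
    set Y : ℕ → Ω → ℝ := fun n w => U n w - c * φ n with hY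
    have hYm : ∀ n, Measurable (Y n) := fun n => (hUm n).sub_const _
    have hYi : iIndepFun Y P := hUi.comp (fun n x => x - c * φ n) fun n => by fun_prop
    have hUint : ∀ n, Integrable (U n) P := fun n => (hζint n).add (hFint n)
    have hYmean : ∀ n, ∫ w, Y n w ∂P = 0 := fun n => by
      simp only [hY]
      rw [integral_sub (hUint n) (integrable_const _)]
      simp only [hU]
      rw [integral_add (hζint n) (hFint n), hζmean, hFmean]
      simp
    have hUle : ∀ n w, |U n w| ≤ |ζ n w| + |c| := fun n w => by
      rcases hχ_val n w with h | h <;> simp [hU, hF, h]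
    have hU2 : ∀ n, MemLp (U n) 2 P := fun n =>
      ((hζ2 n).abs.add (memLp_const |c|)).mono (hUm n).aestronglyMeasurable
        (Filter.Eventually.of_forall fun w => by
          rw [Real.norm_eq_abs, Real.norm_eq_abs]
          exact (hUle n w).trans (le_abs_self _))
    have hY2 : ∀ n, MemLp (Y n) 2 P := fun n => (hU2 n).sub (memLp_const _)
    have hYvar : ∀ n, Var[Y n; P] ≤ ∫ w, (|ζ 0 w| + |c|) ^ 2 ∂P := fun n => by
      have h1 : Var[Y n; P] = Var[U n; P] := by
        simp only [hY]; exact variance_sub_const (hUm n).aestronglyMeasurable _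
      have hm : Measurable fun x : ℝ => (|x| + |c|) ^ 2 := by fun_prop
      have hid := ((hζid n).comp hm).integral_eq
      simp only [Function.comp_apply] at hid
      rw [h1, ← hid]
      refine (variance_le_expectation_sq (hUm n).aestronglyMeasurable).trans ?_
      refine integral_mono (hU2 n).integrable_sq
        ((hζ2 n).abs.add (memLp_const |c|)).integrable_sq fun w => ?_
      simp only [Pi.pow_apply]
      rw [← sq_abs (U n w)]
      exact pow_le_pow_left₀ (abs_nonneg _) (hUle n w) 2
    have hbound := ae_exists_abs_sum_le hYm hYi hY2 hYmean hYvar hγ1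
    have hsum : ∀ w n, ∑ k ∈ Finset.range n, Y k w =
        (p w).potential n - c * ∑ k ∈ Finset.range n, φ k := fun w n => by
      rw [hpot, Finset.mul_sum, ← Finset.sum_sub_distrib]
    simp only [hsum] at hbound
    have hΦ : ∀ n : ℕ, 2 ≤ n → (n : ℝ) ^ (1 - β) / 2 ≤ ∑ k ∈ Finset.range n, φ k :=
      fun n hn => le_sum_of_eq_rpow_neg hβ0 (hφ01 0).1 hφ hn
    refine ⟨fun hδ0 => ?_, fun hδ0 => ?_⟩
    · have hcpos : 0 < c := Real.log_pos ((one_lt_div hden).2 (by linarith))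
      filter_upwards [hbound] with w ⟨B, hB⟩
      exact (p w).isRecurrent_of_not_summable (not_summable_exp_of_abs_sub_le hcpos hγ2 hΦ hB)
    · have hcneg : c < 0 :=
        Real.log_neg (div_pos (by linarith) hden) ((div_lt_one hden).2 (by linarith))
      filter_upwards [hbound] with w ⟨B, hB⟩
      exact (p w).isTransient_of_summable
        (summable_exp_of_abs_sub_le hcneg (by linarith) hγ2 hΦ hB)
  · -- the perturbation is `o(√n)` in `L¹`, so the fluctuations of `∑ ζ` prevail
    have hv : 0 < Var[ζ 0; P] := by
      rwa [variance_of_integral_eq_zero (hζm 0).aemeasurable (hζmean 0)]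
    obtain ⟨θ, hθ0, hθ⟩ := exists_le_measure_sum_add_nonneg hζi hζid (hζ2 0) (hζmean 0) hv
      (D := fun n w => ∑ k ∈ Finset.range n, F k w)
      (fun n => Finset.measurable_sum _ fun k _ => hFm k)
      (fun n => integrable_finsetSum _ fun k _ => hFint k)
      (tendsto_integral_abs_sum_div_sqrt hFint hFabs (isLittleO_sum_sqrt hβ2 hφ))
    simp only [← Finset.sum_add_distrib] at hθ
    filter_upwards [ae_not_summable_exp_sum hUm hUi hθ0 hθ] with w hw
    refine (p w).isRecurrent_of_not_summable ?_
    simpa only [hpot] using hw
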